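/- Let $d\in\mathbb{N}$ and let $\boldsymbol{\phi}=(\phi_1,\ldots,\phi_d):[-1,1]\to\mathbb{R}^d$ be continuous. Let $\boldsymbol{\Xi}$ be the embedding quasimatrix whose $i$-th row is the function $\phi_i$, i.e. the operator $L^2([-1,1])\to\mathbb{R}^d$, $f\mapsto\big(\int_{-1}^1\phi_i f\,dx\big)_{i=1}^d$, and let $s_1\ge s_2\ge\cdots$ be its singular values (the square roots of the eigenvalues of $\boldsymbol{\Xi}\boldsymbol{\Xi}^*$). For points $x_1,\ldots,x_L\in[-1,1]$ let $\boldsymbol{\Psi}=[\boldsymbol{\phi}(x_1)\ \cdots\ \boldsymbol{\phi}(x_L)]\in\mathbb{R}^{d\times L}$ be the embedded input matrix, with singular values $\sigma_1\ge\sigma_2\ge\cdots$. Singular values beyond the dimensions of $\boldsymbol{\Xi}$ or $\boldsymbol{\Psi}$ are $0$ by convention. 1. Let $\nu\ge 1$ be an integer and $V\ge 0$. Suppose that for every $i$, $\phi_i$ and its derivatives through $\phi_i^{(\nu-1)}$ are absolutely continuous on $[-1,1]$, and the derivative $\phi_i^{(\nu)}$ of $\phi_i^{(\nu-1)}$ (which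 exists almost everywhere) agrees almost everywhere with a function of total variation at most $V$ on $[-1,1]$. Then for every integer $j>\nu+1$, $$s_{j+1}\le\frac{4\sqrt{d}\,V}{\pi\nu(j-1-\nu)^\nu},$$ and for every $L\in\mathbb{N}$ and all $x_1,\ldots,x_L\in[-1,1]$, $$\sigma_{j+1}\le\frac{2\sqrt{dL}\,V}{\pi\nu(j-1-\nu)^\nu}.$$ 2. Let $\rho>1$ and $M\in\mathbb{R}$. Suppose that every $\phi_i$ has an analytic continuation to the open Bernstein ellipse $E_\rho=\{(w+w^{-1})/2:\ \rho^{-1}<|w|<\rho\}\subset\mathbb{C}$ that is bounded in absolute value by $M$ there. Then for every integer $j\ge 1$, $$s_{j+1}\le\frac{4\sqrt{d}\,M\rho^{-j+1}}{\rho-1},$$ and for every $L\in\mathbb{N}$ and all $x_1,\ldots,x_L\in[-1,1]$, $$\sigma_{j+1}\le\frac{2\sqrt{dL}\,M\rho^{-j+1}}{\rho-1}.$$ -/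

import Mathlib

open MeasureTheory

/-- The Lebesgue measure on the interval `[-1, 1]`. -/
noncomputable def intervalMeasure : Measure ℝ := volume.restrict (Set.Icc (-1 : ℝ) 1)

instance : IsFiniteMeasure intervalMeasure := by
  unfold intervalMeasure
  infer_instance

/-- The coordinates of a continuous map `[-1, 1] → ℝ^d` are square integrable. -/
theorem memLp_coord {d : ℕ} {φ : ℝ → EuclideanSpace ℝ (Fin d)}
    (hφ : ContinuousOn φ (Set.Icc (-1) 1)) (i : Fin d) :
    MemLp (fun x => φ x i) 2 intervalMeasure := by
  have hc : ContinuousOn (fun x => φ x i) (Set.Icc (-1 : ℝ) 1) :=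
    (EuclideanSpace.proj (𝕜 := ℝ) i).continuous.comp_continuousOn hφ
  obtain ⟨C, hC⟩ := isCompact_Icc.exists_bound_of_continuousOn hc
  refine MemLp.of_bound (hc.aestronglyMeasurable measurableSet_Icc) C ?_
  exact (ae_restrict_iff' measurableSet_Icc).2 (Filter.Eventually.of_forall hC)

/-- The `d × [-1, 1]` quasimatrix whose `i`-th row is the function `φ_i`, acting on
`L²([-1, 1])` by `(Ξ f)_i = ∫ φ_i(x) f(x) dx` (the `L²` inner product with `φ_i`). -/
noncomputable def quasimatrix {d : ℕ} (φ : ℝ → EuclideanSpace ℝ (Fin d))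
    (hφ : ContinuousOn φ (Set.Icc (-1) 1)) :
    Lp ℝ 2 intervalMeasure →L[ℝ] EuclideanSpace ℝ (Fin d) :=
  (EuclideanSpace.equiv (Fin d) ℝ).symm.toContinuousLinearMap ∘L
    ContinuousLinearMap.pi fun i => innerSL ℝ ((memLp_coord hφ i).toLp (fun x => φ x i))

/-- The singular values of a bounded operator `T` from a Hilbert space to a finite-dimensional
inner product space: the square roots of the eigenvalues of `T T*`, in decreasing order and with
multiplicity, continued by zero. They are indexed from zero, so that `singularValue T j` is the
`(j + 1)`-st singular value. -/
noncomputable def singularValue {E F : Type*}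
    [NormedAddCommGroup E] [InnerProductSpace ℝ E] [CompleteSpace E]
    [NormedAddCommGroup F] [InnerProductSpace ℝ F] [CompleteSpace F] [FiniteDimensional ℝ F]
    (T : E →L[ℝ] F) (j : ℕ) : ℝ :=
  if h : j < Module.finrank ℝ F then
    √((ContinuousLinearMap.isPositive_self_comp_adjoint T).isSymmetric.eigenvalues rfl ⟨j, h⟩)
  else 0

/-- The embedded input matrix `Ψ = [φ(x_1) ⋯ φ(x_L)]`, of size `d × L`. -/
def embeddedMatrix {d L : ℕ} (φ : ℝ → EuclideanSpace ℝ (Fin d)) (x : Fin L → ℝ) :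
    Matrix (Fin d) (Fin L) ℝ :=
  Matrix.of fun i k => φ (x k) i

/-- On `[-1, 1]`, `f` and its derivatives through the `(ν - 1)`-st are absolutely continuous, and
the `ν`-th derivative, which then exists almost everywhere, has total variation at most `V` (as
an almost everywhere defined function: after a change on a null set). -/
def HasDerivOfBoundedVariation (ν : ℕ) (V : ℝ) (f : ℝ → ℝ) : Prop :=
  (∀ k < ν,
    AbsolutelyContinuousOnInterval (iteratedDerivWithin k f (Set.Icc (-1) 1)) (-1) 1) ∧
  ∃ g : ℝ → ℝ, g =ᵐ[intervalMeasure] iteratedDerivWithin ν f (Set.Icc (-1) 1) ∧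
    eVariationOn g (Set.Icc (-1) 1) ≤ ENNReal.ofReal V

/-- The open Bernstein ellipse `E_ρ` (foci `±1`, sum of the semi-axes `ρ`), as the image of the
annulus `ρ⁻¹ < |w| < ρ` under the Joukowsky map `w ↦ (w + w⁻¹) / 2`. -/
def bernsteinEllipse (ρ : ℝ) : Set ℂ :=
  (fun w : ℂ => (w + w⁻¹) / 2) '' {w : ℂ | ρ⁻¹ < ‖w‖ ∧ ‖w‖ < ρ}

/-- `f : [-1, 1] → ℝ` has an analytic continuation to the open Bernstein ellipse `E_ρ` that is
bounded by `M` there. -/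
def IsAnalyticBoundedOnEllipse (ρ M : ℝ) (f : ℝ → ℝ) : Prop :=
  ∃ F : ℂ → ℂ, AnalyticOnNhd ℂ F (bernsteinEllipse ρ) ∧
    (∀ x ∈ Set.Icc (-1 : ℝ) 1, F x = f x) ∧ ∀ z ∈ bernsteinEllipse ρ, ‖F z‖ ≤ M

/-! Truncating the Chebyshev series of every `φ_i` after the terms of degree below `j` approximates
the rows by combinations of the same `j` functions `cos (k arccos x)`. This is an approximation of
rank at most `j`, so the `(j+1)`-st singular value is at most the norm of the remainder. If every
coordinate is approximated within `B` on `[-1, 1]`, that norm is at most `√(2d) B` for the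
quasimatrix and `√(dL) B` for the matrix of samples (`singularValue_quasimatrix_le`,
`singularValues_embeddedMatrix_le`).

`B` is a bound on the tail of the Chebyshev coefficients (`abs_sub_chebSum_le`). For a `ν`-th
derivative of variation at most `V`, integrating by parts `ν` times and then once more against the
variation gives `|c_k| ≤ 2V / (π k(k-1)⋯(k-ν))`, whose tail telescopes. For an analytic function on
the ellipse, moving a contour from the unit circle towards radius `ρ` gives `|c_k| ≤ 2M ρ^(-k)`,
whose tail is geometric. -/

/-! ### Singular values and the adjoint of the quasimatrix -/

/-- Courant–Fischer upper bound. -/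
theorem LinearMap.IsSymmetric.eigenvalues_le_of_forall_inner_le {F : Type*} [NormedAddCommGroup F]
    [InnerProductSpace ℝ F] [FiniteDimensional ℝ F] {S : F →ₗ[ℝ] F} (hS : S.IsSymmetric) {n : ℕ}
    (hn : Module.finrank ℝ F = n) {j : ℕ} (hj : j < n) (ℓ : F →ₗ[ℝ] (Fin j → ℝ)) {c : ℝ}
    (h : ∀ u, ℓ u = 0 → inner ℝ (S u) u ≤ c * ‖u‖ ^ 2) :
    hS.eigenvalues hn ⟨j, hj⟩ ≤ c := by
  set b := hS.eigenvectorBasis hn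
  let e : Fin (j + 1) → Fin n := Fin.castLE hj
  let W : (Fin (j + 1) → ℝ) →ₗ[ℝ] F := Fintype.linearCombination ℝ (fun i => b (e i))
  have he : Function.Injective e := Fin.castLE_injective _
  have hW : Function.Injective W :=
    (b.orthonormal.linearIndependent.comp e he).fintypeLinearCombination_injective
  -- The span of the top `j + 1` eigenvectors meets the kernel of the `j` functionals nontrivially.
  obtain ⟨a, ha, ha0⟩ : ∃ a, a ∈ LinearMap.ker (ℓ ∘ₗ W) ∧ a ≠ 0 :=
    (Submodule.ne_bot_iff _).1 (LinearMap.ker_ne_bot_of_finrank_lt (by simp))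
  have hu : ℓ (W a) = 0 := ha
  have hWa : W a = ∑ i, a i • b (e i) := rfl
  have hSW : S (W a) = ∑ i, (hS.eigenvalues hn (e i) * a i) • b (e i) := by
    rw [hWa, map_sum]
    refine Finset.sum_congr rfl fun i _ => ?_
    rw [map_smul, hS.apply_eigenvectorBasis hn, smul_smul, mul_comm]
    rfl
  have ho : Orthonormal ℝ (fun i => b (e i)) := b.orthonormal.comp e he
  have h1 : inner ℝ (S (W a)) (W a) = ∑ i, hS.eigenvalues hn (e i) * a i ^ 2 := by
    rw [hSW, hWa, ho.inner_sum]
    refine Finset.sum_congr rfl fun i _ => ?_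
    simp; ring
  have h2 : ‖W a‖ ^ 2 = ∑ i, a i ^ 2 := by
    rw [← real_inner_self_eq_norm_sq, hWa, ho.inner_sum]
    refine Finset.sum_congr rfl fun i _ => ?_
    simp; ring
  have h3 : hS.eigenvalues hn ⟨j, hj⟩ * ‖W a‖ ^ 2 ≤ inner ℝ (S (W a)) (W a) := by
    rw [h1, h2, Finset.mul_sum]
    refine Finset.sum_le_sum fun i _ => mul_le_mul_of_nonneg_right ?_ (sq_nonneg _)
    refine hS.eigenvalues_antitone hn ?_
    rw [Fin.le_def]
    simp only [e, Fin.val_castLE]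
    omega
  have h4 : 0 < ‖W a‖ ^ 2 := by
    have : W a ≠ 0 := fun h0 => ha0 (hW (by rw [h0, map_zero]))
    positivity
  exact le_of_mul_le_mul_right (h3.trans (h _ hu)) h4

theorem singularValue_le_of_forall_adjoint {E F : Type*}
    [NormedAddCommGroup E] [InnerProductSpace ℝ E] [CompleteSpace E]
    [NormedAddCommGroup F] [InnerProductSpace ℝ F] [CompleteSpace F] [FiniteDimensional ℝ F]
    (T : E →L[ℝ] F) {j : ℕ} (ℓ : F →ₗ[ℝ] (Fin j → ℝ)) {c : ℝ} (hc : 0 ≤ c)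
    (h : ∀ u, ℓ u = 0 → ‖ContinuousLinearMap.adjoint T u‖ ≤ c * ‖u‖) :
    singularValue T j ≤ c := by
  unfold singularValue
  split_ifs with hj
  · refine Real.sqrt_le_iff.2 ⟨hc, ?_⟩
    refine LinearMap.IsSymmetric.eigenvalues_le_of_forall_inner_le _ rfl hj ℓ fun u hu => ?_
    have : inner ℝ (T (ContinuousLinearMap.adjoint T u)) u
        = ‖ContinuousLinearMap.adjoint T u‖ ^ 2 := by
      rw [← ContinuousLinearMap.adjoint_inner_right, real_inner_self_eq_norm_sq]
    refine (le_of_eq this).trans ?_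
    rw [← mul_pow]
    exact pow_le_pow_left₀ (norm_nonneg _) (h u hu) 2
  · exact hc

theorem LinearMap.singularValues_le_of_forall_norm_le {E F : Type*}
    [NormedAddCommGroup E] [InnerProductSpace ℝ E] [FiniteDimensional ℝ E]
    [NormedAddCommGroup F] [InnerProductSpace ℝ F] [FiniteDimensional ℝ F]
    (T : E →ₗ[ℝ] F) {j : ℕ} (ℓ : E →ₗ[ℝ] (Fin j → ℝ)) {c : ℝ} (hc : 0 ≤ c)
    (h : ∀ u, ℓ u = 0 → ‖T u‖ ≤ c * ‖u‖) :
    T.singularValues j ≤ c := by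
  rcases lt_or_ge j (Module.finrank ℝ E) with hj | hj
  · rw [T.singularValues_of_lt rfl hj]
    refine Real.sqrt_le_iff.2 ⟨hc, ?_⟩
    refine LinearMap.IsSymmetric.eigenvalues_le_of_forall_inner_le _ rfl hj ℓ fun u hu => ?_
    rw [LinearMap.comp_apply, LinearMap.adjoint_inner_left, real_inner_self_eq_norm_sq, ← mul_pow]
    exact pow_le_pow_left₀ (norm_nonneg _) (h u hu) 2
  · rw [T.singularValues_of_finrank_le hj]
    exact hc

theorem EuclideanSpace.norm_le_sqrt_card_mul {d : ℕ} {u : EuclideanSpace ℝ (Fin d)} {B : ℝ}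
    (hB : 0 ≤ B) (h : ∀ i, |u i| ≤ B) : ‖u‖ ≤ √d * B := by
  rw [EuclideanSpace.norm_eq]
  refine Real.sqrt_le_iff.2 ⟨by positivity, ?_⟩
  calc ∑ i, ‖u i‖ ^ 2 ≤ ∑ _i : Fin d, B ^ 2 :=
        Finset.sum_le_sum fun i _ => pow_le_pow_left₀ (norm_nonneg _) (h i) 2
    _ = (√d * B) ^ 2 := by
        rw [mul_pow, Real.sq_sqrt (Nat.cast_nonneg d)]
        simp

theorem adjoint_quasimatrix_apply {d : ℕ} (φ : ℝ → EuclideanSpace ℝ (Fin d))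
    (hφ : ContinuousOn φ (Set.Icc (-1) 1)) (u : EuclideanSpace ℝ (Fin d)) :
    ContinuousLinearMap.adjoint (quasimatrix φ hφ) u
      =ᵐ[intervalMeasure] fun x => inner ℝ u (φ x) := by
  have h : ContinuousLinearMap.adjoint (quasimatrix φ hφ) u
      = ∑ i, u i • (memLp_coord hφ i).toLp (fun x => φ x i) := by
    refine ext_inner_right ℝ fun f => ?_
    rw [ContinuousLinearMap.adjoint_inner_left, sum_inner, PiLp.inner_apply]
    refine Finset.sum_congr rfl fun i _ => ?_
    rw [real_inner_smul_left]
    simp [quasimatrix, mul_comm]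
  rw [h]
  have h1 := Lp.coeFn_finsetSum (p := 2) (μ := intervalMeasure) Finset.univ
    (fun i => u i • (memLp_coord hφ i).toLp (fun x => φ x i))
  refine h1.trans ?_
  have h2 : ∀ᵐ x ∂intervalMeasure, ∀ i,
      (u i • (memLp_coord hφ i).toLp (fun x => φ x i) : Lp ℝ 2 intervalMeasure) x
        = u i * φ x i := by
    rw [ae_all_iff]
    intro i
    filter_upwards [Lp.coeFn_smul (u i) ((memLp_coord hφ i).toLp (fun x => φ x i)),
      (memLp_coord hφ i).coeFn_toLp] with x hx hx'
    rw [hx, Pi.smul_apply, hx', smul_eq_mul]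
  filter_upwards [h2] with x hx
  simp [hx, PiLp.inner_apply, mul_comm]

/-- The interval has measure 2, so the sharp factor is `√2`. Rounding it up to 2 gives the constant
4 in the bounds for the quasimatrix. -/
theorem norm_le_two_mul_of_ae_bound {f : Lp ℝ 2 intervalMeasure} {C : ℝ} (hC : 0 ≤ C)
    (h : ∀ᵐ x ∂intervalMeasure, ‖f x‖ ≤ C) : ‖f‖ ≤ 2 * C := by
  have h1 := Lp.norm_le_of_ae_bound (p := 2) hC h
  refine h1.trans (mul_le_mul_of_nonneg_right ?_ hC)
  have : measureUnivNNReal intervalMeasure = 2 := by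
    simp only [measureUnivNNReal, intervalMeasure]
    norm_num
    rfl
  rw [this]
  calc (((2 : NNReal) ^ ((2 : ENNReal).toReal)⁻¹ : NNReal) : ℝ) = (2 : ℝ) ^ ((2 : ℝ)⁻¹) := by
        simp
    _ ≤ 2 ^ (1 : ℝ) := Real.rpow_le_rpow_of_exponent_le (by norm_num) (by norm_num)
    _ = 2 := by simp

/-! ### From uniform approximation to singular values -/

section Approximation

variable {d j : ℕ} {φ : ℝ → EuclideanSpace ℝ (Fin d)} {t : Fin j → ℝ → ℝ}
  {a : Fin d → Fin j → ℝ} {B : ℝ}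

theorem singularValue_quasimatrix_le (hφ : ContinuousOn φ (Set.Icc (-1) 1)) (hB : 0 ≤ B)
    (h : ∀ x ∈ Set.Icc (-1 : ℝ) 1, ∀ i, |φ x i - ∑ k, a i k * t k x| ≤ B) :
    singularValue (quasimatrix φ hφ) j ≤ 2 * (√d * B) := by
  -- A vector orthogonal to the `j` coefficient columns does not see the approximant, so `⟨u, φ x⟩`
  -- only involves the remainder `r`.
  let ℓ : EuclideanSpace ℝ (Fin d) →ₗ[ℝ] (Fin j → ℝ) :=
    LinearMap.pi fun k => (innerₛₗ ℝ (WithLp.toLp 2 fun i => a i k))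
  refine singularValue_le_of_forall_adjoint _ ℓ (by positivity) fun u hu => ?_
  rw [mul_assoc 2]
  refine norm_le_two_mul_of_ae_bound (by positivity) ?_
  have hmem : ∀ᵐ x ∂intervalMeasure, x ∈ Set.Icc (-1 : ℝ) 1 :=
    ae_restrict_mem measurableSet_Icc
  filter_upwards [adjoint_quasimatrix_apply φ hφ u, hmem] with x hx hx1
  let r : EuclideanSpace ℝ (Fin d) := WithLp.toLp 2 fun i => φ x i - ∑ k, a i k * t k x
  have hr : inner ℝ u (φ x) = inner ℝ u r := by
    have h0 : ∀ k, ∑ i, a i k * u i = 0 := fun k => by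
      have := congrFun hu k
      simpa [ℓ, PiLp.inner_apply, mul_comm] using this
    have h1 : ∑ i, u i * ∑ k, a i k * t k x = 0 := by
      simp_rw [Finset.mul_sum]
      rw [Finset.sum_comm]
      refine Finset.sum_eq_zero fun k _ => ?_
      rw [← mul_zero (t k x), ← h0 k, Finset.mul_sum]
      exact Finset.sum_congr rfl fun i _ => by ring
    simp only [PiLp.inner_apply, r]
    simp only [inner_sub_right, Finset.sum_sub_distrib]
    simp only [RCLike.inner_apply, conj_trivial]
    simp_rw [mul_comm _ (u _)]
    rw [h1, sub_zero]
  rw [hx, hr, mul_comm]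
  exact (norm_inner_le_norm u r).trans
    (mul_le_mul_of_nonneg_left (EuclideanSpace.norm_le_sqrt_card_mul hB (h x hx1))
      (norm_nonneg u))

theorem singularValues_embeddedMatrix_le (hB : 0 ≤ B)
    (h : ∀ x ∈ Set.Icc (-1 : ℝ) 1, ∀ i, |φ x i - ∑ k, a i k * t k x| ≤ B)
    {L : ℕ} {x : Fin L → ℝ} (hx : ∀ l, x l ∈ Set.Icc (-1 : ℝ) 1) :
    (Matrix.toEuclideanLin (embeddedMatrix φ x)).singularValues j ≤ √((d : ℝ) * L) * B := by
  -- Here the eigenvalues are those of `Ψ* Ψ` on `ℝ^L`, so the constraints are orthogonality to the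
  -- sampled functions `t k`, not to the coefficients.
  let ℓ : EuclideanSpace ℝ (Fin L) →ₗ[ℝ] (Fin j → ℝ) :=
    LinearMap.pi fun k => (innerₛₗ ℝ (WithLp.toLp 2 fun l => t k (x l)))
  refine LinearMap.singularValues_le_of_forall_norm_le _ ℓ (by positivity) fun u hu => ?_
  rw [Real.sqrt_mul (Nat.cast_nonneg d), mul_assoc, mul_assoc]
  refine EuclideanSpace.norm_le_sqrt_card_mul (by positivity) fun i => ?_
  let r : EuclideanSpace ℝ (Fin L) :=
    WithLp.toLp 2 fun l => φ (x l) i - ∑ k, a i k * t k (x l)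
  have hr : Matrix.toEuclideanLin (embeddedMatrix φ x) u i = inner ℝ u r := by
    have h0 : ∀ k, ∑ l, t k (x l) * u l = 0 := fun k => by
      have := congrFun hu k
      simpa [ℓ, PiLp.inner_apply, mul_comm] using this
    have h1 : ∑ l, u l * ∑ k, a i k * t k (x l) = 0 := by
      simp_rw [Finset.mul_sum]
      rw [Finset.sum_comm]
      refine Finset.sum_eq_zero fun k _ => ?_
      rw [← mul_zero (a i k), ← h0 k, Finset.mul_sum]
      exact Finset.sum_congr rfl fun l _ => by ring
    simp only [PiLp.inner_apply, r]
    simp only [inner_sub_right, Finset.sum_sub_distrib]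
    simp only [RCLike.inner_apply, conj_trivial]
    simp_rw [mul_comm _ (u _)]
    rw [h1, sub_zero]
    simp [Matrix.toLpLin_apply, Matrix.mulVec, dotProduct, embeddedMatrix, mul_comm]
  rw [hr]
  calc |inner ℝ u r| ≤ ‖u‖ * ‖r‖ := abs_real_inner_le_norm u r
    _ ≤ ‖u‖ * (√L * B) := by
      gcongr
      exact EuclideanSpace.norm_le_sqrt_card_mul hB fun l => h _ (hx l) i
    _ = √L * (B * ‖u‖) := by ring

end Approximation

/-! ### Chebyshev series as Fourier cosine series -/

/-- The Chebyshev coefficients of a function on `[-1, 1]`. -/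
noncomputable def chebCoeff (f : ℝ → ℝ) (k : ℕ) : ℝ :=
  2 / Real.pi * ∫ θ in (0 : ℝ)..Real.pi, f (Real.cos θ) * Real.cos (k * θ)

theorem integral_cexp_mul_comp_cos {f : ℝ → ℝ} (hf : ContinuousOn f (Set.Icc (-1) 1)) (n : ℤ) :
    ∫ θ in (-Real.pi)..Real.pi, Complex.exp (-n * θ * Complex.I) * (f (Real.cos θ) : ℂ)
      = (Real.pi * chebCoeff f n.natAbs : ℝ) := by
  have hc : Continuous fun θ : ℝ =>
      Complex.exp (-n * θ * Complex.I) * (f (Real.cos θ) : ℂ) := by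
    refine Continuous.mul (Complex.continuous_exp.comp (by fun_prop))
      (Complex.continuous_ofReal.comp
        (hf.comp_continuous Real.continuous_cos fun θ => Real.cos_mem_Icc θ))
  have hc' := hc.comp continuous_neg
  simp only [Function.comp_def] at hc'
  have hneg := intervalIntegral.integral_comp_neg (a := 0) (b := Real.pi)
    (fun θ : ℝ => Complex.exp (-n * θ * Complex.I) * (f (Real.cos θ) : ℂ))
  rw [neg_zero] at hneg
  rw [← intervalIntegral.integral_add_adjacent_intervals (b := 0)
    (hc.intervalIntegrable _ _) (hc.intervalIntegrable _ _), ← hneg,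
    ← intervalIntegral.integral_add (hc'.intervalIntegrable _ _) (hc.intervalIntegrable _ _)]
  have : ∀ x : ℝ, Complex.exp (-n * (-x : ℝ) * Complex.I) * (f (Real.cos (-x)) : ℂ)
      + Complex.exp (-n * x * Complex.I) * (f (Real.cos x) : ℂ)
      = ((2 * (f (Real.cos x) * Real.cos (n.natAbs * x)) : ℝ) : ℂ) := fun x => by
    have h1 : Real.cos (n.natAbs * x) = Real.cos (n * x) := by
      rcases Int.natAbs_eq n with h | h
      · conv_rhs => rw [h]
        simp
      · conv_rhs => rw [h]
        simp
    rw [Real.cos_neg, h1]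
    push_cast
    rw [Complex.cos, show -(n : ℂ) * -(x : ℂ) * Complex.I = n * x * Complex.I by ring,
      show -(n : ℂ) * (x : ℂ) * Complex.I = -(n * x) * Complex.I by ring]
    ring
  simp_rw [this]
  rw [intervalIntegral.integral_ofReal, intervalIntegral.integral_const_mul, chebCoeff]
  congr 1
  field_simp

/-- This is the Fourier series of the even function `θ ↦ f (cos θ)`, whose `n`-th coefficient is
`chebCoeff f |n| / 2`. Pairing `n` with `-n` counts `n = 0` twice, hence the extra `chebCoeff f 0 /
2`. -/
theorem hasSum_chebCoeff {f : ℝ → ℝ} (hf : ContinuousOn f (Set.Icc (-1) 1))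
    (hs : Summable (chebCoeff f)) (θ : ℝ) :
    HasSum (fun k : ℕ => chebCoeff f k * Real.cos (k * θ))
      (f (Real.cos θ) + chebCoeff f 0 / 2) := by
  have hT : Fact ((0 : ℝ) < 2 * Real.pi) := ⟨Real.two_pi_pos⟩
  have hfc : Continuous fun θ : ℝ => ((f (Real.cos θ) : ℝ) : ℂ) :=
    Complex.continuous_ofReal.comp
      (hf.comp_continuous Real.continuous_cos fun θ => Real.cos_mem_Icc θ)
  have hper : Function.Periodic (fun θ : ℝ => ((f (Real.cos θ) : ℝ) : ℂ)) (2 * Real.pi) :=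
    fun θ => by simp only [Real.cos_add_two_pi]
  let G : C(AddCircle (2 * Real.pi), ℂ) :=
    ⟨hper.lift, continuous_quot_lift _ hfc⟩
  have hG : ∀ θ : ℝ, G (θ : AddCircle (2 * Real.pi)) = (f (Real.cos θ) : ℂ) := fun θ => rfl
  have hfour : ∀ (n : ℤ) (θ : ℝ), fourier n (θ : AddCircle (2 * Real.pi))
      = Complex.exp (n * θ * Complex.I) := fun n θ => by
    rw [fourier_coe_apply]
    congr 1
    have : (Real.pi : ℂ) ≠ 0 := Complex.ofReal_ne_zero.2 Real.pi_ne_zero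
    push_cast
    field_simp
  have hcoef : ∀ n : ℤ, fourierCoeff G n = (chebCoeff f n.natAbs / 2 : ℝ) := fun n => by
    rw [fourierCoeff_eq_intervalIntegral _ _ (-Real.pi)]
    rw [show -Real.pi + 2 * Real.pi = Real.pi by ring]
    simp only [hfour, hG, Int.cast_neg, smul_eq_mul]
    rw [integral_cexp_mul_comp_cos hf, Complex.real_smul, ← Complex.ofReal_mul]
    congr 1
    field_simp
  have hsum : Summable (fourierCoeff G) := by
    have h1 : Summable fun n : ℕ => ((chebCoeff f n / 2 : ℝ) : ℂ) :=
      Complex.ofRealCLM.summable (hs.div_const 2)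
    refine Summable.of_nat_of_neg ?_ ?_
    · simpa [hcoef] using h1
    · simpa [hcoef] using h1
  have h1 := (has_pointwise_sum_fourier_series_of_summable hsum
    (θ : AddCircle (2 * Real.pi))).nat_add_neg
  have h2 := Complex.hasSum_re h1
  simp only [hG, hfour, hcoef] at h2
  convert h2 using 1
  · funext k
    have e1 : ((k : ℂ) * θ * Complex.I) = ((k * θ : ℝ) : ℂ) * Complex.I := by push_cast; ring
    have e2 : (-(k : ℂ) * θ * Complex.I) = ((-(k * θ) : ℝ) : ℂ) * Complex.I := by
      push_cast; ring
    simp only [Int.natAbs_natCast, Int.natAbs_neg, Int.cast_natCast, Int.cast_neg, smul_eq_mul,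
      Complex.add_re, Complex.re_ofReal_mul, e1, e2, Complex.exp_ofReal_mul_I_re, Real.cos_neg]
    ring
  · simp

/-- The constant term of a Chebyshev series carries a factor `1 / 2`. -/
theorem abs_sub_chebSum_le {f : ℝ → ℝ} (hf : ContinuousOn f (Set.Icc (-1) 1)) {j : ℕ} (hj : 1 ≤ j)
    {b : ℕ → ℝ} {B : ℝ} (hb : ∀ k, |chebCoeff f (k + j)| ≤ b k) (hB : HasSum b B)
    {x : ℝ} (hx : x ∈ Set.Icc (-1 : ℝ) 1) :
    |f x - ∑ k : Fin j, (if (k : ℕ) = 0 then chebCoeff f 0 / 2 else chebCoeff f k)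
      * Real.cos ((k : ℕ) * Real.arccos x)| ≤ B := by
  have hs : Summable (chebCoeff f) := by
    rw [← summable_nat_add_iff j]
    exact Summable.of_norm_bounded hB.summable hb
  have h := hasSum_chebCoeff hf hs (Real.arccos x)
  rw [Real.cos_arccos hx.1 hx.2] at h
  have h1 := (hasSum_nat_add_iff' j).2 h
  have h2 : ∑ k : Fin j, (if (k : ℕ) = 0 then chebCoeff f 0 / 2 else chebCoeff f k)
      * Real.cos ((k : ℕ) * Real.arccos x)
      = ∑ k ∈ Finset.range j, chebCoeff f k * Real.cos (k * Real.arccos x)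
        - chebCoeff f 0 / 2 := by
    rw [Fin.sum_univ_eq_sum_range (fun k => (if k = 0 then chebCoeff f 0 / 2 else chebCoeff f k)
      * Real.cos (k * Real.arccos x))]
    obtain ⟨m, rfl⟩ : ∃ m, j = m + 1 := ⟨j - 1, by omega⟩
    rw [Finset.sum_range_succ', Finset.sum_range_succ']
    simp
    ring
  rw [h2, sub_sub_eq_add_sub, ← h1.tsum_eq, ← Real.norm_eq_abs]
  refine tsum_of_norm_bounded (E := ℝ) hB fun k => ?_
  rw [Real.norm_eq_abs, abs_mul]
  exact (mul_le_of_le_one_right (abs_nonneg _) (Real.abs_cos_le_one _)).trans (hb k)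

/-! ### Coefficient decay from bounded variation -/

theorem sum_mul_sub_eq (h F : ℕ → ℝ) (n : ℕ) :
    ∑ i ∈ Finset.range n, h i * (F (i + 1) - F i)
      = h n * F n - h 0 * F 0 - ∑ i ∈ Finset.range n, (h (i + 1) - h i) * F (i + 1) := by
  induction n with
  | zero => simp
  | succ n ih => rw [Finset.sum_range_succ, Finset.sum_range_succ, ih]; ring

/-- A bound on `|∫ h dF|` by the total variation of `h` and the supremum of `F`. -/
theorem abs_integral_mul_deriv_le_of_eVariationOn_le {h F F' : ℝ → ℝ} {a b V C D : ℝ}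
    (hab : a ≤ b) (hV : 0 ≤ V) (hh : eVariationOn h (Set.Icc a b) ≤ ENNReal.ofReal V)
    (hint : IntervalIntegrable h volume a b)
    (hF : ∀ x, HasDerivAt F (F' x) x) (hF' : Continuous F') (hC : ∀ x, |F x| ≤ C)
    (hD : ∀ x, |F' x| ≤ D) (ha : F a = 0) (hb : F b = 0) :
    |∫ x in a..b, h x * F' x| ≤ V * C := by
  have hC0 : 0 ≤ C := (abs_nonneg _).trans (hC 0)
  have hD0 : 0 ≤ D := (abs_nonneg _).trans (hD 0)
  -- Freeze `h` at the left end of each of `n + 1` equal cells. The error is at most `V * D` times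
  -- the mesh. Abel summation bounds the remaining sum by `V * C`, the boundary terms vanishing
  -- because `F a = F b = 0`.
  have key : ∀ n : ℕ, |∫ x in a..b, h x * F' x| ≤ V * C + V * (D * ((b - a) / (n + 1))) := by
    intro n
    have hN : (0 : ℝ) < n + 1 := by positivity
    set δ : ℝ := (b - a) / (n + 1) with hδ
    have hδ0 : 0 ≤ δ := div_nonneg (by linarith) hN.le
    let t : ℕ → ℝ := fun i => a + i * δ
    have ht : Monotone t := fun i k hik => by
      simp only [t]
      gcongr
    have ht0 : t 0 = a := by simp [t]
    have htN : t (n + 1) = b := by simp only [t, hδ]; push_cast; field_simp; ring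
    have hts : ∀ i, t (i + 1) - t i = δ := fun i => by simp only [t]; push_cast; ring
    have htm : ∀ i ≤ n + 1, t i ∈ Set.Icc a b := fun i hi =>
      ⟨ht0 ▸ ht (Nat.zero_le i), htN ▸ ht hi⟩
    let w : ℕ → ℝ := fun i => (eVariationOn h (Set.Icc (t i) (t (i + 1)))).toReal
    have hsub : ∀ i < n + 1, Set.Icc (t i) (t (i + 1)) ⊆ Set.Icc a b := fun i hi =>
      Set.Icc_subset_Icc (htm i hi.le).1 (htm (i + 1) hi).2
    have hfin : ∀ i < n + 1, BoundedVariationOn h (Set.Icc (t i) (t (i + 1))) := fun i hi =>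
      ne_top_of_le_ne_top ENNReal.ofReal_ne_top ((eVariationOn.mono h (hsub i hi)).trans hh)
    have hw0 : ∀ i, 0 ≤ w i := fun i => ENNReal.toReal_nonneg
    have hwV : ∑ i ∈ Finset.range (n + 1), w i ≤ V := by
      rw [← ENNReal.toReal_sum fun i hi => hfin i (Finset.mem_range.1 hi), eVariationOn.sum' h ht,
        ht0, htN]
      exact ENNReal.toReal_le_of_le_ofReal hV hh
    have hdist : ∀ i < n + 1, ∀ x ∈ Set.Icc (t i) (t (i + 1)), |h x - h (t i)| ≤ w i := by
      intro i hi x hx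
      rw [← Real.dist_eq]
      exact (hfin i hi).dist_le hx ⟨le_rfl, ht (Nat.le_succ i)⟩
    have hIi : ∀ i < n + 1, IntervalIntegrable h volume (t i) (t (i + 1)) := fun i hi =>
      hint.mono_set (by
        rw [Set.uIcc_of_le hab, Set.uIcc_of_le (ht (Nat.le_succ i))]
        exact hsub i hi)
    have hsplit : ∫ x in a..b, h x * F' x
        = ∑ i ∈ Finset.range (n + 1), ∫ x in (t i)..(t (i + 1)), h x * F' x := by
      rw [intervalIntegral.sum_integral_adjacent_intervals fun i hi =>
        (hIi i hi).mul_continuousOn hF'.continuousOn, ht0, htN]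
    have hpiece : ∀ i < n + 1, ∫ x in (t i)..(t (i + 1)), h x * F' x
        = h (t i) * (F (t (i + 1)) - F (t i))
          + ∫ x in (t i)..(t (i + 1)), (h x - h (t i)) * F' x := by
      intro i hi
      rw [← intervalIntegral.integral_eq_sub_of_hasDerivAt (fun x _ => hF x)
        (hF'.intervalIntegrable _ _), ← intervalIntegral.integral_const_mul,
        ← intervalIntegral.integral_add ((hF'.const_mul _).intervalIntegrable _ _)
          (((hIi i hi).sub intervalIntegrable_const).mul_continuousOn hF'.continuousOn)]
      exact intervalIntegral.integral_congr fun x _ => by ring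
    have herr : ∀ i < n + 1, |∫ x in (t i)..(t (i + 1)), (h x - h (t i)) * F' x|
        ≤ w i * (D * δ) := by
      intro i hi
      have := intervalIntegral.norm_integral_le_of_norm_le_const (a := t i) (b := t (i + 1))
        (f := fun x => (h x - h (t i)) * F' x) (C := w i * D) fun x hx => by
          rw [Set.uIoc_of_le (ht (Nat.le_succ i))] at hx
          rw [norm_mul]
          exact mul_le_mul (hdist i hi x ⟨hx.1.le, hx.2⟩) (hD x) (norm_nonneg _) (hw0 i)
      rwa [hts, abs_of_nonneg hδ0, mul_assoc] at this
    rw [hsplit, Finset.sum_congr rfl fun i hi => hpiece i (Finset.mem_range.1 hi),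
      Finset.sum_add_distrib]
    refine (abs_add_le _ _).trans (add_le_add ?_ ?_)
    · rw [sum_mul_sub_eq (fun i => h (t i)) (fun i => F (t i)), ht0, htN, ha, hb]
      simp only [mul_zero, sub_zero, zero_sub, abs_neg]
      refine (Finset.abs_sum_le_sum_abs _ _).trans ?_
      calc ∑ i ∈ Finset.range (n + 1), |(h (t (i + 1)) - h (t i)) * F (t (i + 1))|
          ≤ ∑ i ∈ Finset.range (n + 1), w i * C := by
            refine Finset.sum_le_sum fun i hi => ?_
            rw [abs_mul]
            exact mul_le_mul (hdist i (Finset.mem_range.1 hi) _ ⟨ht (Nat.le_succ i), le_rfl⟩)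
              (hC _) (abs_nonneg _) (hw0 i)
        _ ≤ V * C := by
            rw [← Finset.sum_mul]
            exact mul_le_mul_of_nonneg_right hwV hC0
    · refine (Finset.abs_sum_le_sum_abs _ _).trans ?_
      refine (Finset.sum_le_sum fun i hi => herr i (Finset.mem_range.1 hi)).trans ?_
      rw [← Finset.sum_mul]
      exact mul_le_mul_of_nonneg_right hwV (by positivity)
  have hlim : Filter.Tendsto (fun n : ℕ => V * C + V * (D * ((b - a) / (n + 1)))) Filter.atTop
      (nhds (V * C + V * (D * 0))) := by
    refine Filter.Tendsto.const_add _ (Filter.Tendsto.const_mul _ (Filter.Tendsto.const_mul _ ?_))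
    have := (tendsto_one_div_add_atTop_nhds_zero_nat (𝕜 := ℝ)).const_mul (b - a)
    simpa [div_eq_mul_inv] using this
  simpa using ge_of_tendsto' hlim key

theorem BoundedVariationOn.intervalIntegrable {h : ℝ → ℝ} {a b : ℝ}
    (hh : BoundedVariationOn h (Set.uIcc a b)) : IntervalIntegrable h volume a b := by
  obtain ⟨p, q, hp, hq, rfl⟩ := hh.locallyBoundedVariationOn.exists_monotoneOn_sub_monotoneOn
  exact hp.intervalIntegrable.sub hq.intervalIntegrable

theorem BoundedVariationOn.countable_not_continuousAt {h : ℝ → ℝ} {a b : ℝ}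
    (hh : BoundedVariationOn h (Set.Icc a b)) :
    {x ∈ Set.Ioo a b | ¬ ContinuousAt h x}.Countable := by
  obtain ⟨p, q, hp, hq, rfl⟩ := hh.locallyBoundedVariationOn.exists_monotoneOn_sub_monotoneOn
  refine (hp.countable_not_continuousWithinAt.union hq.countable_not_continuousWithinAt).mono ?_
  rintro x ⟨hx, hxc⟩
  by_contra hcon
  simp only [Set.mem_union, Set.mem_ofPred_eq, not_or, not_and, not_not] at hcon
  have hx' := Set.Ioo_subset_Icc_self hx
  have hn := Icc_mem_nhds hx.1 hx.2
  exact hxc (((hcon.1 hx').continuousAt hn).sub ((hcon.2 hx').continuousAt hn))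

/-- `f` is an `n`-fold primitive on `[-1, 1]`, in the sense of the fundamental theorem of calculus
with countably many exceptional points, of a function of total variation at most `V`. -/
def IsIteratedPrimitive (V : ℝ) : ℕ → (ℝ → ℝ) → Prop
  | 0, f => eVariationOn f (Set.Icc (-1) 1) ≤ ENNReal.ofReal V
  | n + 1, f => ContinuousOn f (Set.Icc (-1) 1) ∧ ∃ g, IsIteratedPrimitive V n g ∧
      ∃ s : Set ℝ, s.Countable ∧ ∀ x ∈ Set.Ioo (-1 : ℝ) 1 \ s, HasDerivAt f (g x) x

theorem eVariationOn_comp_cos_le (f : ℝ → ℝ) :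
    eVariationOn (fun θ => f (Real.cos θ)) (Set.Icc 0 Real.pi)
      ≤ eVariationOn f (Set.Icc (-1) 1) :=
  eVariationOn.comp_le_of_antitoneOn f Real.cos Real.strictAntiOn_cos.antitoneOn
    fun θ _ => Real.cos_mem_Icc θ

theorem IsIteratedPrimitive.intervalIntegrable_comp_cos {V : ℝ} {n : ℕ} {f : ℝ → ℝ}
    (h : IsIteratedPrimitive V n f) :
    IntervalIntegrable (fun θ => f (Real.cos θ)) volume 0 Real.pi := by
  cases n with
  | zero =>
    refine BoundedVariationOn.intervalIntegrable ?_
    rw [Set.uIcc_of_le Real.pi_pos.le]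
    exact ne_top_of_le_ne_top ENNReal.ofReal_ne_top ((eVariationOn_comp_cos_le f).trans h)
  | succ n =>
    exact (h.1.comp_continuous Real.continuous_cos fun θ =>
      Real.cos_mem_Icc θ).intervalIntegrable _ _

/-- Integration by parts for Chebyshev coefficients. -/
theorem chebCoeff_succ_eq {f g : ℝ → ℝ} (hf : ContinuousOn f (Set.Icc (-1) 1)) {s : Set ℝ}
    (hs : s.Countable) (hfg : ∀ x ∈ Set.Ioo (-1 : ℝ) 1 \ s, HasDerivAt f (g x) x)
    (hg : IntervalIntegrable (fun θ => g (Real.cos θ)) volume 0 Real.pi) (k : ℕ) :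
    chebCoeff f (k + 1) = (chebCoeff g k - chebCoeff g (k + 2)) / (2 * (k + 1)) := by
  have hk : (k + 1 : ℝ) ≠ 0 := by positivity
  have hfc : Continuous fun θ : ℝ => f (Real.cos θ) :=
    hf.comp_continuous Real.continuous_cos fun θ => Real.cos_mem_Icc θ
  have hci : ∀ m : ℕ, IntervalIntegrable (fun θ => g (Real.cos θ) * Real.cos (m * θ)) volume 0
      Real.pi := fun m => hg.mul_continuousOn (by fun_prop)
  -- `cos` is injective on `(0, π)`, so the exceptional set stays countable in the variable `θ`.
  have hcount : (Set.Ioo 0 Real.pi ∩ Real.cos ⁻¹' s).Countable := by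
    refine Set.MapsTo.countable_of_injOn (f := Real.cos) (t := s) (fun θ hθ => hθ.2) ?_ hs
    exact Real.injOn_cos.mono fun θ hθ => Set.Ioo_subset_Icc_self hθ.1
  have hprod : ∀ θ : ℝ, Real.sin θ * Real.sin ((k + 1) * θ)
      = (Real.cos (k * θ) - Real.cos ((k + 2 : ℕ) * θ)) / 2 := fun θ => by
    have h1 : (k : ℝ) * θ = (k + 1) * θ - θ := by ring
    have h2 : ((k + 2 : ℕ) : ℝ) * θ = (k + 1) * θ + θ := by push_cast; ring
    rw [h1, h2, Real.cos_sub, Real.cos_add]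
    ring
  have hfi : IntervalIntegrable (fun θ => f (Real.cos θ) * Real.cos ((k + 1 : ℕ) * θ)) volume 0
      Real.pi := (hfc.mul (by fun_prop)).intervalIntegrable _ _
  have hI1 : IntervalIntegrable (fun θ => (g (Real.cos θ) * Real.cos (k * θ)
      - g (Real.cos θ) * Real.cos ((k + 2 : ℕ) * θ)) / (2 * (k + 1))) volume 0 Real.pi :=
    ((hci k).sub (hci (k + 2))).div_const _
  -- The product being differentiated vanishes at `0` and `π`, because of its sine factor.
  have hftc := MeasureTheory.integral_eq_of_hasDerivAt_off_countable
    (fun θ => f (Real.cos θ) * (Real.sin ((k + 1) * θ) / (k + 1)))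
    (fun θ => f (Real.cos θ) * Real.cos ((k + 1 : ℕ) * θ)
      - (g (Real.cos θ) * Real.cos (k * θ)
      - g (Real.cos θ) * Real.cos ((k + 2 : ℕ) * θ)) / (2 * (k + 1)))
    hcount (a := 0) (b := Real.pi) (hfc.mul (by fun_prop)).continuousOn
    (fun θ hθ => ?_) (hfi.sub hI1)
  · have e1 : Real.sin ((k + 1) * Real.pi) = 0 := by
      exact_mod_cast Real.sin_nat_mul_pi (k + 1)
    rw [intervalIntegral.integral_sub hfi hI1, intervalIntegral.integral_div,
      intervalIntegral.integral_sub (hci k) (hci (k + 2)), e1] at hftc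
    simp only [mul_zero, Real.sin_zero, zero_div, sub_self] at hftc
    rw [chebCoeff, sub_eq_zero.1 hftc, chebCoeff, chebCoeff]
    ring
  · rw [min_eq_left Real.pi_pos.le, max_eq_right Real.pi_pos.le] at hθ
    have hmem : Real.cos θ ∈ Set.Ioo (-1 : ℝ) 1 \ s := by
      refine ⟨⟨?_, ?_⟩, fun h => hθ.2 ⟨hθ.1, h⟩⟩
      · rw [← Real.cos_pi]
        exact Real.strictAntiOn_cos ⟨hθ.1.1.le, hθ.1.2.le⟩ ⟨Real.pi_pos.le, le_rfl⟩ hθ.1.2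
      · rw [← Real.cos_zero]
        exact Real.strictAntiOn_cos ⟨le_rfl, Real.pi_pos.le⟩ ⟨hθ.1.1.le, hθ.1.2.le⟩ hθ.1.1
    have hd1 : HasDerivAt (fun θ => f (Real.cos θ)) (g (Real.cos θ) * -Real.sin θ) θ :=
      (hfg _ hmem).comp θ (Real.hasDerivAt_cos θ)
    have hd2 : HasDerivAt (fun θ : ℝ => Real.sin ((k + 1) * θ) / (k + 1))
        (Real.cos ((k + 1) * θ) * ((k + 1) * 1) / (k + 1)) θ :=
      (((hasDerivAt_id θ).const_mul ((k : ℝ) + 1)).sin).div_const _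
    refine (hd1.mul hd2).congr_deriv ?_
    have h3 := hprod θ
    have h4 : g (Real.cos θ) * Real.cos (k * θ) - g (Real.cos θ) * Real.cos ((k + 2 : ℕ) * θ)
        = 2 * (g (Real.cos θ) * (Real.sin θ * Real.sin ((k + 1) * θ))) := by rw [h3]; ring
    rw [h4, Nat.cast_add k 1, Nat.cast_one]
    field_simp
    ring

theorem IsIteratedPrimitive.abs_chebCoeff_le {V : ℝ} (hV : 0 ≤ V) {n : ℕ} {f : ℝ → ℝ}
    (h : IsIteratedPrimitive V n f) {k : ℕ} (hk : n < k) :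
    |chebCoeff f k| ≤ 2 * V / Real.pi * (k.descFactorial (n + 1) : ℝ)⁻¹ := by
  induction n generalizing f k with
  | zero =>
    have hk0 : (0 : ℝ) < k := by exact_mod_cast hk
    have h1 := abs_integral_mul_deriv_le_of_eVariationOn_le (h := fun θ => f (Real.cos θ))
      (F := fun θ => Real.sin (k * θ) / k) (F' := fun θ => Real.cos (k * θ)) (C := 1 / k) (D := 1)
      Real.pi_pos.le hV ((eVariationOn_comp_cos_le f).trans h) h.intervalIntegrable_comp_cos
      (fun θ => by
        refine ((((hasDerivAt_id θ).const_mul (k : ℝ)).sin).div_const (k : ℝ)).congr_deriv ?_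
        simp only [id]
        field_simp)
      (by fun_prop)
      (fun θ => by
        rw [abs_div, abs_of_pos hk0]
        gcongr
        exact Real.abs_sin_le_one _)
      (fun θ => Real.abs_cos_le_one _) (by simp) (by simp [Real.sin_nat_mul_pi])
    rw [chebCoeff, abs_mul, abs_of_pos (by positivity : 0 < 2 / Real.pi)]
    refine (mul_le_mul_of_nonneg_left h1 (by positivity)).trans (le_of_eq ?_)
    simp
    ring
  | succ n ih =>
    obtain ⟨hf, g, hg, s, hs, hfg⟩ := h
    obtain ⟨m, rfl⟩ : ∃ m, k = m + 1 := ⟨k - 1, by omega⟩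
    rw [chebCoeff_succ_eq hf hs hfg hg.intervalIntegrable_comp_cos]
    have h1 := ih hg (k := m) (by omega)
    have h2 := ih hg (k := m + 2) (by omega)
    have hpos : (0 : ℝ) < m.descFactorial (n + 1) := by
      exact_mod_cast Nat.descFactorial_pos.2 (by omega)
    -- Bounding both neighbouring coefficients by the larger estimate, at `m`, yields a factor 2
    -- that cancels the one in `2 * (m + 1)`.
    have h3 : ((m + 2).descFactorial (n + 1) : ℝ)⁻¹ ≤ (m.descFactorial (n + 1) : ℝ)⁻¹ := by
      refine inv_anti₀ hpos ?_
      exact_mod_cast Nat.descFactorial_le _ (by omega)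
    have h4 : 0 ≤ 2 * V / Real.pi := by positivity
    have h5 := (abs_sub (chebCoeff g m) (chebCoeff g (m + 2))).trans
      (add_le_add h1 (h2.trans (mul_le_mul_of_nonneg_left h3 h4)))
    have hm : (0 : ℝ) < m + 1 := by positivity
    rw [abs_div, abs_of_pos (by positivity : (0 : ℝ) < 2 * (m + 1)), div_le_iff₀ (by positivity)]
    refine h5.trans (le_of_eq ?_)
    rw [Nat.succ_descFactorial_succ]
    push_cast
    field_simp
    ring

/-! ### Telescoping the tail -/

theorem inv_descFactorial_eq_sub {ν k : ℕ} (hν : 1 ≤ ν) (hk : ν ≤ k) :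
    ((k + 1).descFactorial (ν + 1) : ℝ)⁻¹
      = (ν : ℝ)⁻¹ * ((k.descFactorial ν : ℝ)⁻¹ - ((k + 1).descFactorial ν : ℝ)⁻¹) := by
  obtain ⟨m, rfl⟩ : ∃ m, ν = m + 1 := ⟨ν - 1, by omega⟩
  obtain ⟨l, rfl⟩ : ∃ l, k = l + (m + 1) := ⟨k - (m + 1), by omega⟩
  have hD : ((l + (m + 1)).descFactorial m : ℝ) ≠ 0 := by
    exact_mod_cast (Nat.descFactorial_pos.2 (by omega)).ne'
  rw [Nat.succ_descFactorial_succ, Nat.succ_descFactorial_succ, Nat.descFactorial_succ,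
    show l + (m + 1) - m = l + 1 by omega]
  push_cast
  have h1 : (l + 1 : ℝ) ≠ 0 := by positivity
  have h2 : (m + 1 : ℝ) ≠ 0 := by positivity
  have h3 : (l + (m + 1) + 1 : ℝ) ≠ 0 := by positivity
  field_simp
  ring

theorem sum_inv_descFactorial_le {ν j : ℕ} (hν : 1 ≤ ν) (hj : ν + 1 < j) (n : ℕ) :
    ∑ k ∈ Finset.range n, ((k + j).descFactorial (ν + 1) : ℝ)⁻¹
      ≤ (ν : ℝ)⁻¹ * (((j : ℝ) - 1 - ν) ^ ν)⁻¹ := by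
  obtain ⟨m, rfl⟩ : ∃ m, j = m + 1 := ⟨j - 1, by omega⟩
  have h1 : ∑ k ∈ Finset.range n, ((k + (m + 1)).descFactorial (ν + 1) : ℝ)⁻¹
      = (ν : ℝ)⁻¹ * ((m.descFactorial ν : ℝ)⁻¹ - ((n + m).descFactorial ν : ℝ)⁻¹) := by
    induction n with
    | zero => simp
    | succ n ih =>
      rw [Finset.sum_range_succ, ih, ← add_assoc, inv_descFactorial_eq_sub hν (by omega),
        add_right_comm n 1 m]
      ring
  -- The telescoped sum leaves `(j-1)(j-2)⋯(j-ν)` with `m = j - 1`. Each factor is at least `j - ν`,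
  -- which is weakened to `j - 1 - ν`.
  have h2 : ((m : ℝ) - ν) ^ ν ≤ m.descFactorial ν := by
    have h := Nat.pow_sub_le_descFactorial m ν
    calc ((m : ℝ) - ν) ^ ν = ((m - ν : ℕ) : ℝ) ^ ν := by rw [Nat.cast_sub (by omega)]
      _ ≤ ((m + 1 - ν : ℕ) : ℝ) ^ ν := by gcongr; omega
      _ ≤ m.descFactorial ν := by exact_mod_cast h
  have h3 : (0 : ℝ) < m - ν := by
    rw [sub_pos]
    exact_mod_cast (by omega : ν < m)
  rw [h1]
  push_cast
  rw [add_sub_cancel_right]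
  refine mul_le_mul_of_nonneg_left ?_ (by positivity)
  exact (sub_le_self _ (by positivity)).trans (inv_anti₀ (by positivity) h2)

theorem IsIteratedPrimitive.abs_sub_chebSum_le {V : ℝ} (hV : 0 ≤ V) {ν : ℕ} (hν : 1 ≤ ν)
    {f : ℝ → ℝ} (h : IsIteratedPrimitive V ν f) (hf : ContinuousOn f (Set.Icc (-1) 1)) {j : ℕ}
    (hj : ν + 1 < j) {x : ℝ} (hx : x ∈ Set.Icc (-1 : ℝ) 1) :
    |f x - ∑ k : Fin j, (if (k : ℕ) = 0 then chebCoeff f 0 / 2 else chebCoeff f k)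
      * Real.cos ((k : ℕ) * Real.arccos x)|
      ≤ 2 * V / (Real.pi * ν * ((j : ℝ) - 1 - ν) ^ ν) := by
  have hb0 : ∀ k : ℕ, 0 ≤ ((k + j).descFactorial (ν + 1) : ℝ)⁻¹ := fun k => by positivity
  have hs := summable_of_sum_range_le hb0 (sum_inv_descFactorial_le hν hj)
  have hle := Real.tsum_le_of_sum_range_le hb0 (sum_inv_descFactorial_le hν hj)
  refine (_root_.abs_sub_chebSum_le hf (by omega)
    (fun k => h.abs_chebCoeff_le hV (by omega : ν < k + j))
    (hs.hasSum.mul_left (2 * V / Real.pi)) hx).trans ?_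
  refine (mul_le_mul_of_nonneg_left hle (by positivity)).trans (le_of_eq ?_)
  rw [← mul_inv, ← div_eq_mul_inv, div_div, mul_assoc]

/-! ### From absolute continuity to iterated primitives -/

/-- An absolutely continuous `u` is the integral of any representative `w` of its derivative, hence
differentiable wherever `w` is continuous. -/
theorem AbsolutelyContinuousOnInterval.hasDerivAt_of_ae_eq {u w : ℝ → ℝ}
    (hu : AbsolutelyContinuousOnInterval u (-1) 1)
    (hw : w =ᵐ[intervalMeasure] derivWithin u (Set.Icc (-1) 1)) {x : ℝ}
    (hx : x ∈ Set.Ioo (-1 : ℝ) 1) (hc : ContinuousAt w x) : HasDerivAt u (w x) x := by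
  have hae : ∀ᵐ y ∂volume.restrict (Set.Ioo (-1 : ℝ) 1), w y = deriv u y := by
    have h1 : ∀ᵐ y ∂volume.restrict (Set.Ioo (-1 : ℝ) 1),
        w y = derivWithin u (Set.Icc (-1) 1) y :=
      ae_restrict_of_ae_restrict_of_subset Set.Ioo_subset_Icc_self hw
    filter_upwards [h1, ae_restrict_mem measurableSet_Ioo] with y hy hy'
    rw [hy, derivWithin_of_mem_nhds (Icc_mem_nhds hy'.1 hy'.2)]
  have hae' : ∀ᵐ y ∂volume.restrict (Set.Ioc (-1 : ℝ) 1), w y = deriv u y := by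
    rwa [← restrict_Ioo_eq_restrict_Ioc]
  have hint : IntervalIntegrable w volume (-1) 1 := by
    refine hu.intervalIntegrable_deriv.congr_ae ?_
    rw [Set.uIoc_of_le (by norm_num)]
    filter_upwards [hae'] with y hy using hy.symm
  have hsub : ∀ y ∈ Set.Icc (-1 : ℝ) 1, Set.uIcc (-1) y ⊆ Set.Icc (-1 : ℝ) 1 := fun y hy => by
    rw [Set.uIcc_of_le hy.1]
    exact Set.Icc_subset_Icc_right hy.2
  have hFTC : ∀ y ∈ Set.Icc (-1 : ℝ) 1, u y = u (-1) + ∫ z in (-1)..y, w z := fun y hy => by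
    have h1 : AbsolutelyContinuousOnInterval u (-1) y :=
      hu.mono (by rw [Set.uIcc_of_le (by norm_num : (-1 : ℝ) ≤ 1)]; exact hsub y hy)
    have h2 : ∫ z in (-1)..y, w z = ∫ z in (-1)..y, deriv u z := by
      refine intervalIntegral.integral_congr_ae_restrict ?_
      rw [Set.uIoc_of_le hy.1]
      exact ae_restrict_of_ae_restrict_of_subset (Set.Ioc_subset_Ioc_right hy.2) hae'
    rw [h2, h1.integral_deriv_eq_sub]
    ring
  have hn := Ioo_mem_nhds hx.1 hx.2
  have hmeas : StronglyMeasurableAtFilter w (nhds x) := by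
    refine ⟨Set.Ioo (-1) 1, hn, ?_⟩
    exact (hint.1.mono_set Set.Ioo_subset_Ioc_self).aestronglyMeasurable
  have hd := (intervalIntegral.integral_hasDerivAt_right (hint.mono_set (by
    rw [Set.uIcc_of_le (by norm_num : (-1 : ℝ) ≤ 1)]
    exact hsub x (Set.Ioo_subset_Icc_self hx))) hmeas hc).const_add (u (-1))
  refine hd.congr_of_eventuallyEq ?_
  filter_upwards [hn] with y hy using hFTC y (Set.Ioo_subset_Icc_self hy)

theorem HasDerivOfBoundedVariation.isIteratedPrimitive {ν : ℕ} (hν : 1 ≤ ν) {V : ℝ} {f : ℝ → ℝ}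
    (h : HasDerivOfBoundedVariation ν V f) : IsIteratedPrimitive V ν f := by
  obtain ⟨hac, g, hg, hgV⟩ := h
  have hcont : ∀ k < ν, ContinuousOn (iteratedDerivWithin k f (Set.Icc (-1) 1)) (Set.Icc (-1) 1) :=
    fun k hk => by
      have := (hac k hk).continuousOn
      rwa [Set.uIcc_of_le (by norm_num)] at this
  have hsucc : ∀ k, iteratedDerivWithin (k + 1) f (Set.Icc (-1) 1)
      = derivWithin (iteratedDerivWithin k f (Set.Icc (-1) 1)) (Set.Icc (-1) 1) := fun k => by
    funext x
    rw [iteratedDerivWithin_succ]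
  have key : ∀ m k : ℕ, k + (m + 1) = ν →
      IsIteratedPrimitive V (m + 1) (iteratedDerivWithin k f (Set.Icc (-1) 1)) := by
    intro m
    induction m with
    | zero =>
      intro k hk
      obtain rfl : ν = k + 1 := hk.symm
      have hbv : BoundedVariationOn g (Set.Icc (-1) 1) :=
        ne_top_of_le_ne_top ENNReal.ofReal_ne_top hgV
      -- At the top order, the exceptional points are the countably many discontinuities of the
      -- representative `g`.
      refine ⟨hcont k (by omega), g, hgV, _, hbv.countable_not_continuousAt, fun x hx => ?_⟩
      rw [hsucc] at hg
      refine (hac k (by omega)).hasDerivAt_of_ae_eq hg hx.1 ?_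
      by_contra hcon
      exact hx.2 ⟨hx.1, hcon⟩
    | succ m ih =>
      intro k hk
      -- Below the top order the next derivative is continuous, so there are no exceptional points.
      refine ⟨hcont k (by omega), _, ih (k + 1) (by omega), ∅, Set.countable_empty,
        fun x hx => ?_⟩
      refine (hac k (by omega)).hasDerivAt_of_ae_eq ?_ hx.1
        ((hcont (k + 1) (by omega)).continuousAt (Icc_mem_nhds hx.1.1 hx.1.2))
      rw [hsucc]
  obtain ⟨m, rfl⟩ : ∃ m, ν = m + 1 := ⟨ν - 1, by omega⟩
  simpa using key m 0 (zero_add _)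

/-! ### Coefficient decay from analyticity -/

/-- With `x = (w + w⁻¹) / 2`, the integral of `w^(-k-1) F(x)` over the unit circle is `iπ` times the
coefficient. Cauchy's theorem moves it to radius `R`, kept below `ρ` because the ellipse is open. -/
theorem IsAnalyticBoundedOnEllipse.abs_chebCoeff_le_of_lt {ρ M R : ℝ} {f : ℝ → ℝ}
    (h : IsAnalyticBoundedOnEllipse ρ M f) (hf : ContinuousOn f (Set.Icc (-1) 1)) (hR : 1 < R)
    (hRρ : R < ρ) (k : ℕ) : |chebCoeff f k| ≤ 2 * M * R⁻¹ ^ k := by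
  obtain ⟨F, hF, hFf, hM⟩ := h
  have hR0 : 0 < R := by linarith
  have hρ0 : 0 < ρ := by linarith
  let g : ℂ → ℂ := fun w => (w⁻¹) ^ (k + 1) * F ((w + w⁻¹) / 2)
  have hmem : ∀ w : ℂ, 1 ≤ ‖w‖ → ‖w‖ ≤ R → (w + w⁻¹) / 2 ∈ bernsteinEllipse ρ := fun w h1 h2 =>
    ⟨w, ⟨(inv_lt_one_of_one_lt₀ (hR.trans hRρ)).trans_le h1, h2.trans_lt hRρ⟩, rfl⟩
  have hd : ∀ w : ℂ, 1 ≤ ‖w‖ → ‖w‖ ≤ R → DifferentiableAt ℂ g w := fun w h1 h2 => by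
    have hw : w ≠ 0 := norm_pos_iff.1 (by linarith)
    have hinv : DifferentiableAt ℂ (fun w : ℂ => w⁻¹) w := differentiableAt_inv hw
    refine (hinv.pow _).mul ?_
    exact DifferentiableAt.comp w (hF _ (hmem w h1 h2)).differentiableAt
      ((differentiableAt_id.add hinv).div_const 2)
  have hcirc : (∮ z in C(0, R), g z) = ∮ z in C(0, 1), g z := by
    refine Complex.circleIntegral_eq_of_differentiable_on_annulus_off_countable one_pos hR.le
      Set.countable_empty (fun z hz => ?_) fun z hz => ?_
    · simp only [Set.mem_sdiff, Metric.mem_closedBall, dist_zero_right, Metric.mem_ball,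
        not_lt] at hz
      exact (hd z hz.2 hz.1).continuousAt.continuousWithinAt
    · simp only [Set.mem_sdiff, Metric.mem_closedBall, dist_zero_right, Metric.mem_ball,
        not_le] at hz
      exact hd z hz.1.2.le hz.1.1.le
  have hbound : ‖∮ z in C(0, R), g z‖ ≤ 2 * Real.pi * R * (R⁻¹ ^ (k + 1) * M) := by
    refine circleIntegral.norm_integral_le_of_norm_le_const hR0.le fun z hz => ?_
    have hz' : ‖z‖ = R := by simpa using hz
    simp only [g, norm_mul, norm_pow, norm_inv, hz']
    refine mul_le_mul_of_nonneg_left (hM _ (hmem z ?_ ?_)) (by positivity) <;> linarith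
  have hint : (∮ z in C(0, 1), g z)
      = Complex.I * ((Real.pi * chebCoeff f k : ℝ) : ℂ) := by
    have hper : Function.Periodic (fun θ : ℝ =>
        Complex.exp (-(k : ℤ) * θ * Complex.I) * (f (Real.cos θ) : ℂ)) (2 * Real.pi) := fun θ => by
      simp only [Real.cos_add_two_pi]
      congr 1
      rw [show (-(k : ℤ) * (θ + 2 * Real.pi : ℝ) * Complex.I : ℂ)
        = -(k : ℤ) * θ * Complex.I + ((-k : ℤ) : ℂ) * (2 * Real.pi * Complex.I) by push_cast; ring,
        Complex.exp_add, Complex.exp_int_mul_two_pi_mul_I, mul_one]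
    have h1 := integral_cexp_mul_comp_cos hf k
    have h2 := hper.intervalIntegral_add_eq 0 (-Real.pi)
    rw [zero_add, show -Real.pi + 2 * Real.pi = Real.pi by ring, h1, Int.natAbs_natCast] at h2
    rw [← h2, circleIntegral, ← intervalIntegral.integral_const_mul]
    refine intervalIntegral.integral_congr fun θ _ => ?_
    simp only [g, deriv_circleMap, circleMap, Complex.ofReal_one, one_mul, zero_add, smul_eq_mul]
    have h3 : (Complex.exp (θ * Complex.I) + (Complex.exp (θ * Complex.I))⁻¹) / 2
        = (Real.cos θ : ℂ) := by
      rw [← Complex.exp_neg, Complex.ofReal_cos, Complex.cos, neg_mul]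
    have h4 : (Complex.exp (θ * Complex.I))⁻¹ ^ k = Complex.exp (-(k : ℤ) * θ * Complex.I) := by
      rw [← Complex.exp_neg, ← Complex.exp_nat_mul]
      congr 1
      push_cast
      ring
    rw [h3, hFf _ (Real.cos_mem_Icc θ), pow_succ, h4]
    have h5 := Complex.exp_ne_zero (θ * Complex.I)
    field_simp
  rw [hcirc, hint, norm_mul, Complex.norm_I, one_mul, Complex.norm_real, norm_mul, Real.norm_eq_abs,
    abs_of_pos Real.pi_pos, Real.norm_eq_abs] at hbound
  refine le_of_mul_le_mul_left (hbound.trans (le_of_eq ?_)) Real.pi_pos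
  rw [pow_succ]
  field_simp

theorem IsAnalyticBoundedOnEllipse.abs_chebCoeff_le {ρ M : ℝ} {f : ℝ → ℝ} (hρ : 1 < ρ)
    (h : IsAnalyticBoundedOnEllipse ρ M f) (hf : ContinuousOn f (Set.Icc (-1) 1)) (k : ℕ) :
    |chebCoeff f k| ≤ 2 * M * ρ⁻¹ ^ k := by
  have hρ0 : ρ ≠ 0 := by linarith
  have ht : Filter.Tendsto (fun R : ℝ => 2 * M * R⁻¹ ^ k) (nhdsWithin ρ (Set.Iio ρ))
      (nhds (2 * M * ρ⁻¹ ^ k)) :=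
    (((continuousAt_inv₀ hρ0).pow k).const_mul (2 * M)).tendsto.mono_left nhdsWithin_le_nhds
  refine ge_of_tendsto ht ?_
  filter_upwards [Ioo_mem_nhdsLT hρ] with R hR
  exact h.abs_chebCoeff_le_of_lt hf hR.1 hR.2 k

theorem IsAnalyticBoundedOnEllipse.nonneg {ρ M : ℝ} {f : ℝ → ℝ} (hρ : 1 < ρ)
    (h : IsAnalyticBoundedOnEllipse ρ M f) : 0 ≤ M := by
  obtain ⟨F, -, -, hM⟩ := h
  exact (norm_nonneg _).trans (hM _ ⟨1, by simpa using ⟨inv_lt_one_of_one_lt₀ hρ, hρ⟩, rfl⟩)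

theorem IsAnalyticBoundedOnEllipse.abs_sub_chebSum_le {ρ M : ℝ} {f : ℝ → ℝ} (hρ : 1 < ρ)
    (h : IsAnalyticBoundedOnEllipse ρ M f) (hf : ContinuousOn f (Set.Icc (-1) 1)) {j : ℕ}
    (hj : 1 ≤ j) {x : ℝ} (hx : x ∈ Set.Icc (-1 : ℝ) 1) :
    |f x - ∑ k : Fin j, (if (k : ℕ) = 0 then chebCoeff f 0 / 2 else chebCoeff f k)
      * Real.cos ((k : ℕ) * Real.arccos x)| ≤ 2 * M * ρ ^ (-(j : ℤ) + 1) / (ρ - 1) := by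
  have hρ0 : 0 < ρ := by linarith
  have hg := (hasSum_geometric_of_lt_one (inv_nonneg.2 hρ0.le)
    (inv_lt_one_of_one_lt₀ hρ)).mul_left (2 * M * ρ⁻¹ ^ j)
  refine (_root_.abs_sub_chebSum_le hf hj (fun k => ?_) hg hx).trans (le_of_eq ?_)
  · rw [mul_assoc (2 * M), ← pow_add, add_comm j]
    exact h.abs_chebCoeff_le hρ hf _
  · have h1 : ρ - 1 ≠ 0 := by linarith
    rw [zpow_add₀ hρ0.ne', zpow_neg, zpow_natCast, zpow_one, inv_pow]
    have h2 : 1 - ρ⁻¹ ≠ 0 := by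
      rw [← one_div, one_sub_div hρ0.ne']
      exact div_ne_zero h1 hρ0.ne'
    field_simp
-- Conclusion
theorem mainTheorem2 {d : ℕ} (φ : ℝ → EuclideanSpace ℝ (Fin d))
    (hφ : ContinuousOn φ (Set.Icc (-1) 1)) :
    (∀ (ν : ℕ) (V : ℝ), 1 ≤ ν → 0 ≤ V →
      (∀ i, HasDerivOfBoundedVariation ν V (fun x => φ x i)) →
      ∀ j : ℕ, ν + 1 < j →
        singularValue (quasimatrix φ hφ) j
            ≤ 4 * √(d : ℝ) * V / (Real.pi * ν * ((j : ℝ) - 1 - ν) ^ ν) ∧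
        ∀ (L : ℕ) (x : Fin L → ℝ), (∀ k, x k ∈ Set.Icc (-1 : ℝ) 1) →
          (Matrix.toEuclideanLin (embeddedMatrix φ x)).singularValues j
            ≤ 2 * √((d : ℝ) * L) * V / (Real.pi * ν * ((j : ℝ) - 1 - ν) ^ ν)) ∧
    (∀ ρ M : ℝ, 1 < ρ →
      (∀ i, IsAnalyticBoundedOnEllipse ρ M (fun x => φ x i)) →
      ∀ j : ℕ, 1 ≤ j →
        singularValue (quasimatrix φ hφ) j
            ≤ 4 * √(d : ℝ) * M * ρ ^ (-(j : ℤ) + 1) / (ρ - 1) ∧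
        ∀ (L : ℕ) (x : Fin L → ℝ), (∀ k, x k ∈ Set.Icc (-1 : ℝ) 1) →
          (Matrix.toEuclideanLin (embeddedMatrix φ x)).singularValues j
            ≤ 2 * √((d : ℝ) * L) * M * ρ ^ (-(j : ℤ) + 1) / (ρ - 1)) := by
  have hc : ∀ i, ContinuousOn (fun x => φ x i) (Set.Icc (-1) 1) := fun i =>
    (EuclideanSpace.proj (𝕜 := ℝ) i).continuous.comp_continuousOn hφ
  refine ⟨fun ν V hν hV h j hj => ?_, fun ρ M hρ h j hj => ?_⟩
  · have hj' : (0 : ℝ) < (j : ℝ) - 1 - ν := by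
      have : ((ν + 1 : ℕ) : ℝ) < j := by exact_mod_cast hj
      push_cast at this
      linarith
    have hB : 0 ≤ 2 * V / (Real.pi * ν * ((j : ℝ) - 1 - ν) ^ ν) := by positivity
    have happ := fun (x : ℝ) (hx : x ∈ Set.Icc (-1 : ℝ) 1) (i : Fin d) =>
      ((h i).isIteratedPrimitive hν).abs_sub_chebSum_le hV hν (hc i) hj hx
    refine ⟨(singularValue_quasimatrix_le hφ hB happ).trans (le_of_eq ?_), fun L x hx =>
      (singularValues_embeddedMatrix_le hB happ hx).trans (le_of_eq ?_)⟩ <;> ring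
  -- For `d = 0` the hypothesis is vacuous and `M` may be negative, but both right-hand sides are 0.
  -- For `d > 0` a coordinate forces `0 ≤ M`.
  · rcases Nat.eq_zero_or_pos d with rfl | hd
    · have happ : ∀ x ∈ Set.Icc (-1 : ℝ) 1, ∀ i : Fin 0,
          |φ x i - ∑ k : Fin j, (0 : ℝ) * 0| ≤ 0 := fun x _ i => i.elim0
      refine ⟨(singularValue_quasimatrix_le (a := fun _ _ => 0) (t := fun _ _ => 0) hφ le_rfl
        happ).trans (le_of_eq ?_), fun L x hx => (singularValues_embeddedMatrix_le
          (a := fun _ _ => 0) (t := fun _ _ => 0) le_rfl happ hx).trans (le_of_eq ?_)⟩ <;> simp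
    · have hM : 0 ≤ M := (h ⟨0, hd⟩).nonneg hρ
      have hρ1 : 0 < ρ - 1 := by linarith
      have hρ0 : 0 < ρ := by linarith
      have hB : 0 ≤ 2 * M * ρ ^ (-(j : ℤ) + 1) / (ρ - 1) := by positivity
      have happ := fun (x : ℝ) (hx : x ∈ Set.Icc (-1 : ℝ) 1) (i : Fin d) =>
        (h i).abs_sub_chebSum_le hρ (hc i) hj hx
      refine ⟨(singularValue_quasimatrix_le hφ hB happ).trans (le_of_eq ?_), fun L x hx =>
        (singularValues_embeddedMatrix_le hB happ hx).trans (le_of_eq ?_)⟩ <;> ring
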